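/- For an odd prime $n$, let $H(n)$ be the group of matrices $(x,y,z)=\begin{pmatrix}1&x&z\\0&1&y\\0&0&1\end{pmatrix}$ with $x,y,z\in\mathbb{Z}/n\mathbb{Z}$, under matrix multiplication. Let $r_1,s_1,r_2,s_2\in\mathbb{Z}/n\mathbb{Z}$ with $r_1s_2\not\equiv r_2s_1 \pmod n$, and let $S\subset H(n)$ be either the set $\{(s_1,r_1,0),(-s_1,-r_1,0),(s_2,r_2,0),(-s_2,-r_2,0)\}$ or the symmetric set $\{(s_1,r_1,0)^{\pm1},(s_2,r_2,0)^{\pm1}\}$. Let $P_k$ be the distribution after $k$ steps of the random walk on $H(n)$ that starts at the identity and at each step multiplies on the right by an independent, uniformly chosen element of $S$, let $U$ be the uniform distribution on $H(n)$, and let $\|P-Q\|_{TV}=\frac12\sum_{g\in H(n)}|P(g)-Q(g)|$. Then order $n^2$ steps are necessary and sufficient for the walk to become uniform: there are constants $a,b,B>0$, independent of $n,r_1,s_1,r_2,s_2,S$ and $k$, such that for all integers $k\ge0$ $$\tfrac12\,e^{-ak/n^2}\;\le\;\|P_k-U\|_{TV}\;\le\;B\,e^{-bk/n^2}.$$ 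-/

import Mathlib

/-- The Heisenberg group over `R`: the triple `(x, y, z)` stands for the upper unitriangular matrix
`!![1, x, z; 0, 1, y; 0, 0, 1]`. -/
@[ext]
structure Heisenberg (R : Type*) where
  x : R
  y : R
  z : R

namespace Heisenberg

/-- The matrix that a triple stands for. -/
def toMatrix {R : Type*} [CommRing R] (g : Heisenberg R) : Matrix (Fin 3) (Fin 3) R :=
  !![1, g.x, g.z; 0, 1, g.y; 0, 0, 1]

/-- Multiplication is matrix multiplication; see `toMatrix_mul`, `toMatrix_one` and
`toMatrix_injective`. -/
instance {R : Type*} [CommRing R] : Mul (Heisenberg R) where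
  mul g h := ⟨g.x + h.x, g.y + h.y, g.z + h.z + g.x * h.y⟩

instance {R : Type*} [CommRing R] : One (Heisenberg R) where
  one := ⟨0, 0, 0⟩

instance {R : Type*} [CommRing R] : Inv (Heisenberg R) where
  inv g := ⟨-g.x, -g.y, -g.z + g.x * g.y⟩

theorem mul_def {R : Type*} [CommRing R] (g h : Heisenberg R) :
    g * h = ⟨g.x + h.x, g.y + h.y, g.z + h.z + g.x * h.y⟩ := rfl

theorem one_def {R : Type*} [CommRing R] : (1 : Heisenberg R) = ⟨0, 0, 0⟩ := rfl

theorem inv_def {R : Type*} [CommRing R] (g : Heisenberg R) :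
    g⁻¹ = ⟨-g.x, -g.y, -g.z + g.x * g.y⟩ := rfl

instance {R : Type*} [CommRing R] : Group (Heisenberg R) where
  mul_assoc a b c := by ext <;> simp only [mul_def] <;> ring
  one_mul a := by ext <;> simp [mul_def, one_def]
  mul_one a := by ext <;> simp [mul_def, one_def]
  inv_mul_cancel a := by ext <;> simp [mul_def, one_def, inv_def]

theorem toMatrix_injective {R : Type*} [CommRing R] :
    Function.Injective (toMatrix : Heisenberg R → Matrix (Fin 3) (Fin 3) R) := by
  intro g h e
  ext
  · simpa [toMatrix] using congrFun (congrFun e 0) 1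
  · simpa [toMatrix] using congrFun (congrFun e 1) 2
  · simpa [toMatrix] using congrFun (congrFun e 0) 2

theorem toMatrix_one {R : Type*} [CommRing R] : toMatrix (1 : Heisenberg R) = 1 := by
  change toMatrix (mk 0 0 0) = 1
  ext i j
  fin_cases i <;> fin_cases j <;> simp [toMatrix]

theorem toMatrix_mul {R : Type*} [CommRing R] (g h : Heisenberg R) :
    toMatrix (g * h) = toMatrix g * toMatrix h := by
  change toMatrix (mk (g.x + h.x) (g.y + h.y) (g.z + h.z + g.x * h.y)) = _
  ext i j
  fin_cases i <;> fin_cases j <;> simp [toMatrix, Matrix.mul_apply, Fin.sum_univ_three] <;> ring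

/-- A group element as a triple of coordinates. -/
def equivProd (R : Type*) : Heisenberg R ≃ R × R × R where
  toFun g := (g.x, g.y, g.z)
  invFun t := ⟨t.1, t.2.1, t.2.2⟩
  left_inv _ := rfl
  right_inv _ := rfl

instance {R : Type*} [DecidableEq R] : DecidableEq (Heisenberg R) := (equivProd R).decidableEq

instance {R : Type*} [Fintype R] : Fintype (Heisenberg R) := Fintype.ofEquiv _ (equivProd R).symm

/-- The step set `{(s₁, r₁, 0), (-s₁, -r₁, 0), (s₂, r₂, 0), (-s₂, -r₂, 0)}`, the negatives being
taken coordinatewise. -/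
def negSteps {R : Type*} [CommRing R] [DecidableEq R] (r₁ s₁ r₂ s₂ : R) : Finset (Heisenberg R) :=
  {⟨s₁, r₁, 0⟩, ⟨-s₁, -r₁, 0⟩, ⟨s₂, r₂, 0⟩, ⟨-s₂, -r₂, 0⟩}

/-- The symmetric step set `{(s₁, r₁, 0)^±1, (s₂, r₂, 0)^±1}`, with inverses in the group. -/
def invSteps {R : Type*} [CommRing R] [DecidableEq R] (r₁ s₁ r₂ s₂ : R) : Finset (Heisenberg R) :=
  {⟨s₁, r₁, 0⟩, (⟨s₁, r₁, 0⟩ : Heisenberg R)⁻¹, ⟨s₂, r₂, 0⟩, (⟨s₂, r₂, 0⟩ : Heisenberg R)⁻¹}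

end Heisenberg

/-- The law after `k` steps of the random walk on a group that starts at the identity and at each
step multiplies on the right by an independent, uniformly chosen element of `S`. -/
noncomputable def walkLaw {H : Type*} [Group H] (S : Finset H) (hS : S.Nonempty) : ℕ → PMF H
  | 0 => PMF.pure 1
  | k + 1 => (walkLaw S hS k).bind fun g => (PMF.uniformOfFinset S hS).map fun s => g * s

/-- Total variation distance of two probability distributions on a finite set. -/
noncomputable def tvDist {α : Type*} [Fintype α] (p q : PMF α) : ℝ :=
  (1 / 2) * ∑ a, |(p a).toReal - (q a).toReal|

/-! ### Almost commuting isometries -/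

section Isometries

variable {E : Type*} [NormedAddCommGroup E] [InnerProductSpace ℂ E]

/-- An uncertainty principle: two isometries that commute up to the scalar `q` cannot both nearly
fix a vector. -/
theorem norm_sub_one_mul_norm_sq_le_of_commute_smul (U V : E →ₗᵢ[ℂ] E) {q : ℂ}
    (h : ∀ f, U (V f) = q • V (U f)) (f : E) :
    ‖q - 1‖ * ‖f‖ ^ 2 ≤ (1 + ‖q - 1‖) * (‖f - U f‖ ^ 2 + ‖f - V f‖ ^ 2) := by
  have key (T : E →ₗᵢ[ℂ] E) (b : E) : ‖inner ℂ f (b - T b)‖ ≤ ‖f - T f‖ * ‖b‖ := by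
    have e : inner ℂ f (b - T b) = inner ℂ (T f - f) (T b) := by
      rw [inner_sub_right, inner_sub_left, T.inner_map_map]
    rw [e]
    refine (norm_inner_le_norm _ _).trans ?_
    rw [T.norm_map, norm_sub_rev]
  have h₁ := key U (f - V f)
  have h₂ := key V (f - U f)
  have e : (q - 1) * inner ℂ f (V (U f)) =
      inner ℂ f ((f - V f) - U (f - V f)) - inner ℂ f ((f - U f) - V (f - U f)) := by
    rw [← inner_smul_right, ← inner_sub_right, sub_smul, ← h, one_smul]
    congr 1
    simp only [map_sub]
    abel
  have h₃ : ‖q - 1‖ * ‖inner ℂ f (V (U f))‖ ≤ ‖f - U f‖ ^ 2 + ‖f - V f‖ ^ 2 := by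
    rw [← norm_mul, e]
    refine (norm_sub_le _ _).trans ?_
    nlinarith [sq_nonneg (‖f - U f‖ - ‖f - V f‖)]
  have h₄ : ‖f - V (U f)‖ ≤ ‖f - V f‖ + ‖f - U f‖ := by
    have : f - V (U f) = (f - V f) + V (f - U f) := by simp only [map_sub]; abel
    rw [this]
    refine (norm_add_le _ _).trans ?_
    rw [V.norm_map]
  have h₅ : ‖f‖ ^ 2 - (‖f - U f‖ ^ 2 + ‖f - V f‖ ^ 2) ≤ ‖inner ℂ f (V (U f))‖ := by
    have e := norm_sub_sq (𝕜 := ℂ) f (V (U f))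
    rw [V.norm_map, U.norm_map] at e
    have h₆ : RCLike.re (inner ℂ f (V (U f))) ≤ ‖inner ℂ f (V (U f))‖ := RCLike.re_le_norm _
    have h₇ : ‖f - V (U f)‖ ^ 2 ≤ (‖f - V f‖ + ‖f - U f‖) ^ 2 := by gcongr
    nlinarith [sq_nonneg (‖f - U f‖ - ‖f - V f‖)]
  have := mul_le_mul_of_nonneg_left h₅ (norm_nonneg (q - 1))
  nlinarith

/-- The isometry `α⁻¹ • (A ∘ A)` for a complex number `α` of norm one. -/
noncomputable def LinearIsometry.scaledSquare (A : E →ₗᵢ[ℂ] E) (α : ℂ) (hα : ‖α‖ = 1) :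
    E →ₗᵢ[ℂ] E where
  toLinearMap := α⁻¹ • (A.toLinearMap ∘ₗ A.toLinearMap)
  norm_map' f := by simp [norm_smul, hα]

theorem LinearIsometry.scaledSquare_apply (A : E →ₗᵢ[ℂ] E) (α : ℂ) (hα : ‖α‖ = 1) (f : E) :
    A.scaledSquare α hα f = α⁻¹ • A (A f) := rfl

/-- If `A'` is a scalar multiple of the inverse of `A`, then `A + A'` contracts `f` unless
the rescaled square of `A` nearly fixes `f`. -/
theorem norm_add_sq_add_norm_sub_scaledSquare_sq (A : E →ₗᵢ[ℂ] E) {α : ℂ} (hα : ‖α‖ = 1)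
    {f g : E} (h : A g = α • f) :
    ‖A f + g‖ ^ 2 + ‖f - A.scaledSquare α hα f‖ ^ 2 = 4 * ‖f‖ ^ 2 := by
  have hα0 : α ≠ 0 := by rintro rfl; simp at hα
  have e : ‖A f + g‖ = ‖f + A.scaledSquare α hα f‖ := by
    rw [← A.norm_map, map_add, h, LinearIsometry.scaledSquare_apply]
    have : A (A f) + α • f = α • (f + α⁻¹ • A (A f)) := by
      rw [smul_add, smul_inv_smul₀ hα0, add_comm]
    rw [this, norm_smul, hα, one_mul]
  have p := parallelogram_law_with_norm ℂ f (A.scaledSquare α hα f)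
  rw [(A.scaledSquare α hα).norm_map] at p
  rw [e]
  linarith

/-- The average of two isometries commuting up to the scalar `q` and of scalar multiples of their
inverses is a strict contraction if `q ^ 4 ≠ 1`. -/
theorem norm_average_sq_le (A B : E →ₗᵢ[ℂ] E) {α β q : ℂ} (hα : ‖α‖ = 1) (hβ : ‖β‖ = 1)
    (hq : ‖q‖ = 1) (h : ∀ f, A (B f) = q • B (A f)) {f g g' : E} (hg : A g = α • f)
    (hg' : B g' = β • f) :
    ‖(4⁻¹ : ℂ) • (A f + g + (B f + g'))‖ ^ 2 ≤ (1 - ‖q ^ 4 - 1‖ / 24) * ‖f‖ ^ 2 := by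
  have h₁ := norm_add_sq_add_norm_sub_scaledSquare_sq A hα hg
  have h₂ := norm_add_sq_add_norm_sub_scaledSquare_sq B hβ hg'
  have hc : ∀ f, A.scaledSquare α hα (B.scaledSquare β hβ f) =
      q ^ 4 • B.scaledSquare β hβ (A.scaledSquare α hα f) := by
    intro f
    simp only [LinearIsometry.scaledSquare_apply, map_smul, h, smul_smul]
    congr 1
    ring
  have h₃ := norm_sub_one_mul_norm_sq_le_of_commute_smul _ _ hc f
  have h₄ : ‖q ^ 4 - 1‖ ≤ 2 := by
    refine (norm_sub_le _ _).trans ?_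
    simp [hq]
    norm_num
  have h₅ : ‖A f + g + (B f + g')‖ ^ 2 ≤ (‖A f + g‖ + ‖B f + g'‖) ^ 2 := by
    gcongr
    exact norm_add_le _ _
  rw [norm_smul, mul_pow]
  norm_num
  set D := ‖f - A.scaledSquare α hα f‖ ^ 2 + ‖f - B.scaledSquare β hβ f‖ ^ 2 with hD
  have hD0 : 0 ≤ D := by positivity
  have h₆ : (1 + ‖q ^ 4 - 1‖) * D ≤ 3 * D := by nlinarith
  nlinarith [sq_nonneg (‖A f + g‖ - ‖B f + g'‖)]

end Isometries

/-! ### The standard additive character -/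

namespace ZMod

variable {n : ℕ} [NeZero n]

theorem norm_stdAddChar (a : ZMod n) : ‖stdAddChar a‖ = 1 := by
  rw [stdAddChar_apply]; exact Circle.norm_coe _

theorem stdAddChar_neg (a : ZMod n) : stdAddChar (-a) = (starRingEnd ℂ) (stdAddChar a) :=
  AddChar.map_neg_eq_conj _ _

theorem stdAddChar_re (j : ℤ) :
    (stdAddChar (j : ZMod n)).re = Real.cos (2 * Real.pi * j / n) := by
  rw [stdAddChar_coe, show 2 * (Real.pi : ℂ) * Complex.I * j / n =
    ((2 * Real.pi * j / n : ℝ) : ℂ) * Complex.I by push_cast; ring, Complex.exp_ofReal_mul_I_re]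

theorem stdAddChar_re_le (a : ZMod n) :
    (stdAddChar a).re ≤ 1 - 8 * ((a.valMinAbs : ℝ) / n) ^ 2 := by
  have hn : (0 : ℝ) < n := by exact_mod_cast Nat.pos_of_ne_zero (NeZero.ne n)
  conv_lhs => rw [← coe_valMinAbs a, stdAddChar_re]
  have hm := valMinAbs_mem_Ioc a
  have h₁ : -(n : ℝ) ≤ a.valMinAbs * 2 := by exact_mod_cast hm.1.le
  have h₂ : (a.valMinAbs : ℝ) * 2 ≤ n := by exact_mod_cast hm.2
  have h₃ : |2 * Real.pi * a.valMinAbs / n| ≤ Real.pi := by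
    rw [abs_le, le_div_iff₀ hn, div_le_iff₀ hn]
    constructor <;> nlinarith [Real.pi_pos]
  refine (Real.cos_le_one_sub_mul_cos_sq h₃).trans (le_of_eq ?_)
  field_simp
  ring

theorem norm_stdAddChar_sub_one_sq (a : ZMod n) :
    ‖stdAddChar a - 1‖ ^ 2 = 2 * (1 - (stdAddChar a).re) := by
  have h := norm_stdAddChar a
  have h₂ : ‖stdAddChar a‖ ^ 2 = 1 := by rw [h]; norm_num
  rw [← Complex.normSq_eq_norm_sq, Complex.normSq_apply] at h₂ ⊢
  simp
  linarith

theorem four_div_le_norm_stdAddChar_sub_one {a : ZMod n} (ha : a ≠ 0) :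
    4 / (n : ℝ) ≤ ‖stdAddChar a - 1‖ := by
  have hn : (0 : ℝ) < n := by exact_mod_cast Nat.pos_of_ne_zero (NeZero.ne n)
  refine le_of_sq_le_sq ?_ (norm_nonneg _)
  rw [norm_stdAddChar_sub_one_sq]
  have h := stdAddChar_re_le a
  have h₁ : (1 : ℝ) ≤ (a.valMinAbs : ℝ) ^ 2 := by
    have : a.valMinAbs ≠ 0 := by simpa using ha
    exact_mod_cast Int.add_one_le_iff.mpr (sq_pos_of_ne_zero this)
  have h₂ : (1 : ℝ) / n ^ 2 ≤ ((a.valMinAbs : ℝ) / n) ^ 2 := by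
    rw [div_pow]; gcongr
  have h₃ : (4 / (n : ℝ)) ^ 2 = 16 * (1 / n ^ 2) := by field_simp; norm_num
  rw [h₃]
  linarith

/-- Plancherel's formula on `ZMod n`. -/
theorem sum_norm_sq_sum_stdAddChar_mul (f : ZMod n → ℂ) :
    ∑ m, ‖∑ z, f z * stdAddChar (m * z)‖ ^ 2 = n * ∑ z, ‖f z‖ ^ 2 := by
  have h : ∑ m, (∑ z, f z * stdAddChar (m * z)) *
      (starRingEnd ℂ) (∑ z, f z * stdAddChar (m * z)) =
      n * ∑ z, f z * (starRingEnd ℂ) (f z) := by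
    simp_rw [map_sum, map_mul, ← stdAddChar_neg, Finset.sum_mul_sum]
    rw [Finset.sum_comm, Finset.mul_sum]
    refine Finset.sum_congr rfl fun z _ => ?_
    rw [Finset.sum_comm]
    have (w : ZMod n) : ∑ m, f z * stdAddChar (m * z) *
        ((starRingEnd ℂ) (f w) * stdAddChar (-(m * w))) =
        f z * (starRingEnd ℂ) (f w) * if z - w = 0 then (n : ℂ) else 0 := by
      have s := AddChar.sum_mulShift (z - w) (isPrimitive_stdAddChar n)
      rw [ZMod.card] at s
      push_cast at s
      rw [← s, Finset.mul_sum]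
      refine Finset.sum_congr rfl fun m _ => ?_
      rw [mul_sub, sub_eq_add_neg, AddChar.map_add_eq_mul]
      ring
    simp_rw [this, sub_eq_zero]
    simp
    ring
  simp_rw [Complex.mul_conj'] at h
  exact_mod_cast h

end ZMod

/-! ### Sums over `ZMod n` -/

namespace ZMod

theorem sum_val_eq_sum_range {M : Type*} [AddCommMonoid M] (n : ℕ) [NeZero n] (g : ℕ → M) :
    ∑ a : ZMod n, g a.val = ∑ j ∈ Finset.range n, g j := by
  obtain ⟨N, rfl⟩ := Nat.exists_eq_succ_of_ne_zero (NeZero.ne n)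
  exact Fin.sum_univ_eq_sum_range g (N + 1)

theorem sum_pow_natAbs_valMinAbs_le (n : ℕ) [NeZero n] {x : ℝ} (hx : 0 ≤ x) (hx' : x ≤ 1 / 2) :
    ∑ a : ZMod n, x ^ a.valMinAbs.natAbs ≤ 1 + 4 * x := by
  have h₁ (a : ZMod n) : x ^ a.valMinAbs.natAbs ≤
      if a.val = 0 then 1 else x ^ a.val + x ^ (n - a.val) := by
    split_ifs with h
    · rw [ZMod.val_eq_zero] at h
      simp [h]
    · rw [valMinAbs_natAbs_eq_min]
      rcases min_choice a.val (n - a.val) with e | e <;> rw [e]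
      · exact le_add_of_nonneg_right (by positivity)
      · exact le_add_of_nonneg_left (by positivity)
  refine (Finset.sum_le_sum fun a _ => h₁ a).trans ?_
  rw [sum_val_eq_sum_range n fun j => if j = 0 then 1 else x ^ j + x ^ (n - j)]
  obtain ⟨N, rfl⟩ := Nat.exists_eq_succ_of_ne_zero (NeZero.ne n)
  rw [Finset.sum_range_succ']
  simp only [Nat.succ_eq_add_one, Nat.add_eq_zero_iff, one_ne_zero, and_false, if_false, if_true,
    Nat.add_sub_add_right, Finset.sum_add_distrib]
  have h₂ : ∑ j ∈ Finset.range N, x ^ (N - j) = ∑ j ∈ Finset.range N, x ^ (j + 1) := by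
    rw [← Finset.sum_range_reflect]
    refine Finset.sum_congr rfl fun j hj => ?_
    rw [Finset.mem_range] at hj
    congr 1
    omega
  have h₃ : ∑ j ∈ Finset.range N, x ^ (j + 1) ≤ 2 * x := by
    have e := mul_neg_geom_sum x N
    simp_rw [pow_succ, ← Finset.sum_mul]
    have : 0 ≤ x ^ N := by positivity
    have h₄ : 0 ≤ ∑ j ∈ Finset.range N, x ^ j := Finset.sum_nonneg fun _ _ => by positivity
    nlinarith
  linarith

theorem sum_exp_stdAddChar_re_le {n : ℕ} [NeZero n] {k : ℕ} (hk : n ^ 2 ≤ k) :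
    ∑ a : ZMod n, Real.exp (-(k * (1 - (stdAddChar a).re) / 4)) ≤
      1 + 4 * Real.exp (-(2 * k / n ^ 2)) := by
  have hn : (0 : ℝ) < n := by exact_mod_cast Nat.pos_of_ne_zero (NeZero.ne n)
  have hk' : (n : ℝ) ^ 2 ≤ k := by exact_mod_cast hk
  have hx : Real.exp (-(2 * k / n ^ 2)) ≤ 1 / 2 := by
    have h₁ : (2 : ℝ) ≤ 2 * k / n ^ 2 := by
      rw [le_div_iff₀ (by positivity)]; linarith
    have h₂ := Real.add_one_le_exp (2 * (k : ℝ) / n ^ 2)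
    rw [Real.exp_neg, one_div]
    gcongr
    linarith
  refine le_trans (Finset.sum_le_sum fun a _ => ?_)
    (sum_pow_natAbs_valMinAbs_le n (Real.exp_pos _).le hx)
  rw [← Real.exp_nat_mul, Real.exp_le_exp]
  have h₁ := stdAddChar_re_le a
  have h₂ : (a.valMinAbs.natAbs : ℝ) ≤ (a.valMinAbs : ℝ) ^ 2 := by
    have : ((a.valMinAbs.natAbs : ℤ) : ℝ) ≤ ((a.valMinAbs ^ 2 : ℤ) : ℝ) :=
      Int.cast_le.mpr (Int.natAbs_le_self_sq _)
    rwa [Int.cast_natCast, Int.cast_pow] at this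
  have h₃ : (a.valMinAbs.natAbs : ℝ) * (2 * k / n ^ 2) ≤ a.valMinAbs ^ 2 * (2 * k / n ^ 2) := by
    gcongr
  have h₄ : (k : ℝ) * (8 * ((a.valMinAbs : ℝ) / n) ^ 2) ≤ k * (1 - (stdAddChar a).re) := by
    gcongr
    linarith
  have h₅ : (k : ℝ) * (8 * ((a.valMinAbs : ℝ) / n) ^ 2) =
      4 * (a.valMinAbs ^ 2 * (2 * k / n ^ 2)) := by
    field_simp; ring
  linarith

end ZMod

/-! ### The one-step recurrence of a random walk -/

theorem walkLaw_succ_toReal {H : Type*} [Group H] [Fintype H] [DecidableEq H] (S : Finset H)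
    (hS : S.Nonempty) (k : ℕ) (g : H) :
    (walkLaw S hS (k + 1) g).toReal =
      (S.card : ℝ)⁻¹ * ∑ s ∈ S, (walkLaw S hS k (g * s⁻¹)).toReal := by
  have e : walkLaw S hS (k + 1) g = ∑ s ∈ S, (S.card : ENNReal)⁻¹ * walkLaw S hS k (g * s⁻¹) := by
    simp only [walkLaw, PMF.bind_apply, PMF.map_apply, tsum_fintype, PMF.uniformOfFinset_apply,
      Finset.mul_sum]
    rw [Finset.sum_comm, ← Finset.sum_subset (Finset.subset_univ S)]
    · refine Finset.sum_congr rfl fun s hs => ?_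
      rw [Finset.sum_eq_single (g * s⁻¹)]
      · simp [hs, mul_comm]
      · intro h _ hne
        rw [if_neg, mul_zero]
        rintro rfl
        simp at hne
      · simp
    · intro s _ hs
      simp [hs]
  rw [e, ENNReal.toReal_sum, Finset.mul_sum]
  · refine Finset.sum_congr rfl fun s _ => ?_
    simp [ENNReal.toReal_mul]
  · intro s hs
    refine ENNReal.mul_ne_top ?_ (PMF.apply_ne_top _ _)
    simp
    rintro rfl; simp at hs

theorem PMF.sum_toReal {α : Type*} [Fintype α] (p : PMF α) : ∑ a, (p a).toReal = 1 := by
  rw [← ENNReal.toReal_sum fun a _ => p.apply_ne_top a, ← tsum_fintype (L := .unconditional _),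
    p.tsum_coe,
    ENNReal.toReal_one]

theorem tvDist_le_one {α : Type*} [Fintype α] (p q : PMF α) : tvDist p q ≤ 1 := by
  have : ∑ a, |(p a).toReal - (q a).toReal| ≤ ∑ a, ((p a).toReal + (q a).toReal) := by
    refine Finset.sum_le_sum fun a _ => ?_
    have h₁ : 0 ≤ (p a).toReal := ENNReal.toReal_nonneg
    have h₂ : 0 ≤ (q a).toReal := ENNReal.toReal_nonneg
    rw [abs_le]
    constructor <;> linarith
  rw [Finset.sum_add_distrib, p.sum_toReal, q.sum_toReal] at this
  unfold tvDist
  linarith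

/-- The `ℓ²` bound on the distance to uniformity. -/
theorem four_mul_tvDist_uniform_sq_le {α : Type*} [Fintype α] [Nonempty α] (p : PMF α) :
    4 * tvDist p (PMF.uniformOfFintype α) ^ 2 ≤
      Fintype.card α * ∑ a, (p a).toReal ^ 2 - 1 := by
  have hc : (Fintype.card α : ℝ) ≠ 0 := by exact_mod_cast Fintype.card_ne_zero
  have h := sq_sum_le_card_mul_sum_sq (s := (Finset.univ : Finset α))
    (f := fun a => |(p a).toReal - (PMF.uniformOfFintype α a).toReal|)
  have e : ((Finset.univ : Finset α).card : ℝ) * ∑ a, |(p a).toReal - (PMF.uniformOfFintype α a).toReal| ^ 2 =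
      Fintype.card α * ∑ a, (p a).toReal ^ 2 - 1 := by
    simp only [sq_abs, PMF.uniformOfFintype_apply, ENNReal.toReal_inv, ENNReal.toReal_natCast,
      sub_sq, Finset.sum_add_distrib, Finset.sum_sub_distrib, ← Finset.sum_mul, ← Finset.mul_sum,
      p.sum_toReal, Finset.sum_const, Finset.card_univ, nsmul_eq_mul]
    field_simp
    ring
  rw [e] at h
  unfold tvDist
  linarith

/-- A bounded test function bounds the total variation distance from below. -/
theorem norm_sum_sub_le_two_mul_tvDist {α : Type*} [Fintype α] (p q : PMF α) {F : α → ℂ}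
    (hF : ∀ a, ‖F a‖ ≤ 1) :
    ‖∑ a, ((p a).toReal : ℂ) * F a - ∑ a, ((q a).toReal : ℂ) * F a‖ ≤ 2 * tvDist p q := by
  rw [← Finset.sum_sub_distrib]
  refine (norm_sum_le _ _).trans ?_
  unfold tvDist
  rw [← mul_assoc, mul_one_div_cancel two_ne_zero, one_mul]
  refine Finset.sum_le_sum fun a _ => ?_
  rw [← sub_mul, norm_mul, ← Complex.ofReal_sub, Complex.norm_real, Real.norm_eq_abs]
  exact mul_le_of_le_one_right (abs_nonneg _) (hF a)

/-! ### Fourier analysis on the Heisenberg group -/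

namespace Heisenberg

theorem sum_eq_sum_coordinates {R M : Type*} [Fintype R] [AddCommMonoid M]
    (F : Heisenberg R → M) : ∑ g, F g = ∑ v : R × R, ∑ z, F ⟨v.1, v.2, z⟩ := by
  rw [← (equivProd R).symm.sum_comp, Fintype.sum_prod_type, Fintype.sum_prod_type]
  simp_rw [Fintype.sum_prod_type]
  rfl

theorem card_eq (R : Type*) [Fintype R] : Fintype.card (Heisenberg R) = Fintype.card R ^ 3 := by
  rw [Fintype.card_congr (equivProd R), Fintype.card_prod, Fintype.card_prod]
  ring

variable {n : ℕ} [NeZero n]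

/-- The Fourier transform of a function on the Heisenberg group in the central variable. -/
noncomputable def centralFourier (p : Heisenberg (ZMod n) → ℝ) (m : ZMod n) :
    EuclideanSpace ℂ (ZMod n × ZMod n) :=
  WithLp.toLp 2 fun v => ∑ z, (p ⟨v.1, v.2, z⟩ : ℂ) * ZMod.stdAddChar (m * z)

/-- The transform of `p` at the one-dimensional representation with parameters `α`, `β`. -/
noncomputable def charFourier (p : Heisenberg (ZMod n) → ℝ) (α β : ZMod n) : ℂ :=
  ∑ g, (p g : ℂ) * ZMod.stdAddChar (α * g.x + β * g.y)

theorem sum_norm_centralFourier_sq (p : Heisenberg (ZMod n) → ℝ) :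
    ∑ m, ‖centralFourier p m‖ ^ 2 = n * ∑ g, p g ^ 2 := by
  simp_rw [EuclideanSpace.norm_sq_eq, centralFourier]
  rw [Finset.sum_comm, sum_eq_sum_coordinates, Finset.mul_sum]
  refine Finset.sum_congr rfl fun v _ => ?_
  rw [ZMod.sum_norm_sq_sum_stdAddChar_mul fun z => (p ⟨v.1, v.2, z⟩ : ℂ)]
  simp

theorem sum_norm_charFourier_sq (p : Heisenberg (ZMod n) → ℝ) :
    ∑ w : ZMod n × ZMod n, ‖charFourier p w.1 w.2‖ ^ 2 = n ^ 2 * ‖centralFourier p 0‖ ^ 2 := by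
  have h (α β : ZMod n) : charFourier p α β = ∑ x, (∑ y, centralFourier p 0 (x, y) *
      ZMod.stdAddChar (β * y)) * ZMod.stdAddChar (α * x) := by
    rw [charFourier, sum_eq_sum_coordinates, Fintype.sum_prod_type]
    refine Finset.sum_congr rfl fun x _ => ?_
    rw [Finset.sum_mul]
    refine Finset.sum_congr rfl fun y _ => ?_
    simp only [centralFourier, zero_mul, AddChar.map_zero_eq_one, mul_one, Finset.sum_mul,
      AddChar.map_add_eq_mul]
    refine Finset.sum_congr rfl fun z _ => ?_
    ring
  simp_rw [h]
  rw [Fintype.sum_prod_type_right]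
  simp_rw [ZMod.sum_norm_sq_sum_stdAddChar_mul fun x => ∑ y, centralFourier p 0 (x, y) *
      ZMod.stdAddChar (_ * y)]
  rw [← Finset.mul_sum, Finset.sum_comm]
  simp_rw [ZMod.sum_norm_sq_sum_stdAddChar_mul fun y => centralFourier p 0 (_, y)]
  rw [← Finset.mul_sum, EuclideanSpace.norm_sq_eq, Fintype.sum_prod_type]
  ring

/-- The unitary operator by which right translation by `g` acts on central Fourier transforms. -/
noncomputable def twistedShift (m : ZMod n) (g : Heisenberg (ZMod n)) :
    EuclideanSpace ℂ (ZMod n × ZMod n) →ₗᵢ[ℂ] EuclideanSpace ℂ (ZMod n × ZMod n) where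
  toFun f := WithLp.toLp 2 fun v =>
    ZMod.stdAddChar (m * (g.z + (v.1 - g.x) * g.y)) * f (v.1 - g.x, v.2 - g.y)
  map_add' f f' := by ext v; simp [mul_add]
  map_smul' c f := by ext v; simp; ring
  norm_map' f := by
    refine (sq_eq_sq₀ (norm_nonneg _) (norm_nonneg _)).mp ?_
    rw [EuclideanSpace.norm_sq_eq, EuclideanSpace.norm_sq_eq]
    simp only [LinearMap.coe_mk, AddHom.coe_mk, norm_mul, ZMod.norm_stdAddChar, one_mul]
    exact ((Equiv.subRight g.x).prodCongr (Equiv.subRight g.y)).sum_comp fun v => ‖f v‖ ^ 2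

theorem twistedShift_apply (m : ZMod n) (g : Heisenberg (ZMod n))
    (f : EuclideanSpace ℂ (ZMod n × ZMod n)) (v : ZMod n × ZMod n) :
    twistedShift m g f v =
      ZMod.stdAddChar (m * (g.z + (v.1 - g.x) * g.y)) * f (v.1 - g.x, v.2 - g.y) := rfl

theorem twistedShift_comm (m : ZMod n) (g h : Heisenberg (ZMod n))
    (f : EuclideanSpace ℂ (ZMod n × ZMod n)) :
    twistedShift m g (twistedShift m h f) =
      ZMod.stdAddChar (m * (h.x * g.y - g.x * h.y)) • twistedShift m h (twistedShift m g f) := by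
  ext v
  simp only [twistedShift_apply, PiLp.smul_apply, smul_eq_mul, ← mul_assoc,
    ← AddChar.map_add_eq_mul]
  refine congrArg₂ _ (congrArg _ ?_) (congrArg f.ofLp (Prod.ext ?_ ?_)) <;> ring

theorem twistedShift_twistedShift_neg (m a b c c' : ZMod n)
    (f : EuclideanSpace ℂ (ZMod n × ZMod n)) :
    twistedShift m ⟨a, b, c⟩ (twistedShift m ⟨-a, -b, c'⟩ f) =
      ZMod.stdAddChar (m * (c + c' - a * b)) • f := by
  ext v
  simp only [twistedShift_apply, PiLp.smul_apply, smul_eq_mul, ← mul_assoc,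
    ← AddChar.map_add_eq_mul]
  refine congrArg₂ _ (congrArg _ ?_) (congrArg f.ofLp (Prod.ext ?_ ?_)) <;> ring

theorem centralFourier_translate (p : Heisenberg (ZMod n) → ℝ) (m : ZMod n)
    (g : Heisenberg (ZMod n)) :
    centralFourier (fun h => p (h * g⁻¹)) m = twistedShift m g (centralFourier p m) := by
  ext v
  rw [twistedShift_apply]
  simp only [centralFourier]
  rw [Finset.mul_sum, ← Equiv.sum_comp (Equiv.addRight (g.z + (v.1 - g.x) * g.y))]
  refine Finset.sum_congr rfl fun z _ => ?_
  have e : (⟨v.1, v.2, z + (g.z + (v.1 - g.x) * g.y)⟩ : Heisenberg (ZMod n)) * g⁻¹ =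
      ⟨v.1 - g.x, v.2 - g.y, z⟩ := by
    ext <;> simp only [mul_def, inv_def] <;> ring
  simp only [Equiv.coe_addRight, e]
  rw [mul_add, AddChar.map_add_eq_mul]
  ring

theorem charFourier_translate (p : Heisenberg (ZMod n) → ℝ) (α β : ZMod n)
    (g : Heisenberg (ZMod n)) :
    charFourier (fun h => p (h * g⁻¹)) α β =
      ZMod.stdAddChar (α * g.x + β * g.y) * charFourier p α β := by
  simp only [charFourier]
  rw [Finset.mul_sum, ← Equiv.sum_comp (Equiv.mulRight g)]
  refine Finset.sum_congr rfl fun h _ => ?_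
  simp only [Equiv.coe_mulRight, mul_inv_cancel_right]
  rw [show α * (h * g).x + β * (h * g).y = (α * g.x + β * g.y) + (α * h.x + β * h.y) by
    simp only [mul_def]; ring, AddChar.map_add_eq_mul]
  ring

/-! ### Walks with four steps -/

/-- `p` is the sequence of laws of a walk from the identity with the four equally likely steps
`(a₁, b₁, 0)`, `(-a₁, -b₁, c₁)`, `(a₂, b₂, 0)`, `(-a₂, -b₂, c₂)`. -/
structure IsFourStepWalk (a₁ b₁ c₁ a₂ b₂ c₂ : ZMod n) (p : ℕ → Heisenberg (ZMod n) → ℝ) :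
    Prop where
  zero : ∀ g, p 0 g = if g = 1 then 1 else 0
  succ : ∀ k g, p (k + 1) g =
    4⁻¹ * (p k (g * ⟨a₁, b₁, 0⟩⁻¹) + p k (g * ⟨-a₁, -b₁, c₁⟩⁻¹) +
      (p k (g * ⟨a₂, b₂, 0⟩⁻¹) + p k (g * ⟨-a₂, -b₂, c₂⟩⁻¹)))

namespace IsFourStepWalk

variable {a₁ b₁ c₁ a₂ b₂ c₂ : ZMod n} {p : ℕ → Heisenberg (ZMod n) → ℝ}

theorem centralFourier_succ (hp : IsFourStepWalk a₁ b₁ c₁ a₂ b₂ c₂ p) (k : ℕ) (m : ZMod n) :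
    centralFourier (p (k + 1)) m = (4⁻¹ : ℂ) •
      (twistedShift m ⟨a₁, b₁, 0⟩ (centralFourier (p k) m) +
        twistedShift m ⟨-a₁, -b₁, c₁⟩ (centralFourier (p k) m) +
      (twistedShift m ⟨a₂, b₂, 0⟩ (centralFourier (p k) m) +
        twistedShift m ⟨-a₂, -b₂, c₂⟩ (centralFourier (p k) m))) := by
  simp_rw [← centralFourier_translate]
  ext v
  simp only [centralFourier, hp.succ, PiLp.smul_apply, PiLp.add_apply, smul_eq_mul,
    ← Finset.sum_add_distrib, Finset.mul_sum]
  refine Finset.sum_congr rfl fun z _ => ?_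
  push_cast
  ring

theorem charFourier_succ (hp : IsFourStepWalk a₁ b₁ c₁ a₂ b₂ c₂ p) (k : ℕ) (α β : ZMod n) :
    charFourier (p (k + 1)) α β =
      ((((ZMod.stdAddChar (α * a₁ + β * b₁)).re +
        (ZMod.stdAddChar (α * a₂ + β * b₂)).re) / 2 : ℝ) : ℂ) * charFourier (p k) α β := by
  have e : charFourier (p (k + 1)) α β = (4⁻¹ : ℂ) *
      (charFourier (fun h => p k (h * ⟨a₁, b₁, 0⟩⁻¹)) α β +
        charFourier (fun h => p k (h * ⟨-a₁, -b₁, c₁⟩⁻¹)) α β +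
      (charFourier (fun h => p k (h * ⟨a₂, b₂, 0⟩⁻¹)) α β +
        charFourier (fun h => p k (h * ⟨-a₂, -b₂, c₂⟩⁻¹)) α β)) := by
    simp only [charFourier, hp.succ, ← Finset.sum_add_distrib, Finset.mul_sum]
    refine Finset.sum_congr rfl fun z _ => ?_
    push_cast
    ring
  have h (a b : ZMod n) : ZMod.stdAddChar (α * -a + β * -b) =
      2 * ((ZMod.stdAddChar (α * a + β * b)).re : ℂ) - ZMod.stdAddChar (α * a + β * b) := by
    rw [show α * -a + β * -b = -(α * a + β * b) by ring, ZMod.stdAddChar_neg, eq_sub_iff_add_eq,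
      add_comm, Complex.add_conj]
    push_cast
    ring
  rw [e]
  simp_rw [charFourier_translate, h]
  push_cast
  ring

theorem charFourier_eq (hp : IsFourStepWalk a₁ b₁ c₁ a₂ b₂ c₂ p) (k : ℕ) (α β : ZMod n) :
    charFourier (p k) α β =
      ((((ZMod.stdAddChar (α * a₁ + β * b₁)).re +
        (ZMod.stdAddChar (α * a₂ + β * b₂)).re) / 2 : ℝ) : ℂ) ^ k := by
  induction k with
  | zero =>
    simp only [charFourier, hp.zero, pow_zero]
    rw [Finset.sum_eq_single 1]
    · simp [one_def]
    · intro g _ hg; simp [hg]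
    · simp
  | succ k ih => rw [hp.charFourier_succ, ih, pow_succ']

theorem norm_centralFourier_zero (hp : IsFourStepWalk a₁ b₁ c₁ a₂ b₂ c₂ p) (m : ZMod n) :
    ‖centralFourier (p 0) m‖ = 1 := by
  have : centralFourier (p 0) m = EuclideanSpace.single (0, 0) 1 := by
    ext v
    simp only [centralFourier, hp.zero, one_def, Heisenberg.mk.injEq, PiLp.single_apply,
      Prod.ext_iff]
    rw [Finset.sum_eq_single 0]
    · split_ifs <;> simp_all
    · intro z _ hz; simp [hz]
    · simp
  rw [this]
  simp

end IsFourStepWalk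

end Heisenberg

theorem ZMod.two_ne_zero_of_ne_two {n : ℕ} [Fact n.Prime] (hn : n ≠ 2) : (2 : ZMod n) ≠ 0 := by
  have := Fact.mk Nat.prime_two
  exact_mod_cast ZMod.prime_ne_zero n 2 hn

namespace Heisenberg

namespace IsFourStepWalk

variable {n : ℕ} [Fact n.Prime] {a₁ b₁ c₁ a₂ b₂ c₂ : ZMod n}
  {p : ℕ → Heisenberg (ZMod n) → ℝ}

theorem norm_centralFourier_succ_sq_le (hp : IsFourStepWalk a₁ b₁ c₁ a₂ b₂ c₂ p) (hn : n ≠ 2)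
    (hd : b₁ * a₂ ≠ b₂ * a₁) (k : ℕ) {m : ZMod n} (hm : m ≠ 0) :
    ‖centralFourier (p (k + 1)) m‖ ^ 2 ≤ (1 - 1 / (6 * n)) * ‖centralFourier (p k) m‖ ^ 2 := by
  rw [hp.centralFourier_succ]
  refine (norm_average_sq_le _ _ (ZMod.norm_stdAddChar _) (ZMod.norm_stdAddChar _)
    (ZMod.norm_stdAddChar _) (twistedShift_comm m _ _) (twistedShift_twistedShift_neg _ _ _ _ _ _)
    (twistedShift_twistedShift_neg _ _ _ _ _ _)).trans ?_
  have h2 := ZMod.two_ne_zero_of_ne_two hn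
  have h4 : 4 • (m * (a₂ * b₁ - a₁ * b₂)) ≠ 0 := by
    have e : 4 • (m * (a₂ * b₁ - a₁ * b₂)) = 2 * 2 * (m * (b₁ * a₂ - b₂ * a₁)) := by
      rw [nsmul_eq_mul]; push_cast; ring
    rw [e]
    exact mul_ne_zero (mul_ne_zero h2 h2) (mul_ne_zero hm (sub_ne_zero.mpr hd))
  have h := ZMod.four_div_le_norm_stdAddChar_sub_one h4
  rw [AddChar.map_nsmul_eq_pow] at h
  have e : (1 : ℝ) / (6 * n) = 4 / n / 24 := by
    have : (n : ℝ) ≠ 0 := by exact_mod_cast NeZero.ne n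
    field_simp
    norm_num
  rw [e]
  gcongr

theorem norm_centralFourier_sq_le (hp : IsFourStepWalk a₁ b₁ c₁ a₂ b₂ c₂ p) (hn : n ≠ 2)
    (hd : b₁ * a₂ ≠ b₂ * a₁) (k : ℕ) {m : ZMod n} (hm : m ≠ 0) :
    ‖centralFourier (p k) m‖ ^ 2 ≤ Real.exp (-(k / (6 * n))) := by
  induction k with
  | zero => simp [hp.norm_centralFourier_zero]
  | succ k ih =>
    refine (hp.norm_centralFourier_succ_sq_le hn hd k hm).trans ?_
    have h := Real.one_sub_le_exp_neg (1 / (6 * n : ℝ))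
    calc (1 - 1 / (6 * n : ℝ)) * ‖centralFourier (p k) m‖ ^ 2
        ≤ Real.exp (-(1 / (6 * n))) * Real.exp (-(k / (6 * n))) := by gcongr
      _ = Real.exp (-((k + 1 : ℕ) / (6 * n))) := by
        rw [← Real.exp_add]; push_cast; congr 1; ring

theorem dual_bijective (hd : b₁ * a₂ ≠ b₂ * a₁) :
    Function.Bijective fun w : ZMod n × ZMod n =>
      (w.1 * a₁ + w.2 * b₁, w.1 * a₂ + w.2 * b₂) := by
  rw [← Finite.injective_iff_bijective]
  intro w w' h
  obtain ⟨h₁, h₂⟩ := Prod.ext_iff.mp h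
  simp only at h₁ h₂
  have hd' : b₁ * a₂ - b₂ * a₁ ≠ 0 := sub_ne_zero.mpr hd
  refine Prod.ext (mul_right_cancel₀ hd' ?_) (mul_right_cancel₀ hd' ?_)
  · linear_combination b₁ * h₂ - b₂ * h₁
  · linear_combination a₂ * h₁ - a₁ * h₂

theorem norm_charFourier_sq_le (hp : IsFourStepWalk a₁ b₁ c₁ a₂ b₂ c₂ p) (k : ℕ)
    (α β : ZMod n) :
    ‖charFourier (p k) α β‖ ^ 2 ≤
      Real.exp (-(k * (1 - (ZMod.stdAddChar (2 * (α * a₁ + β * b₁))).re) / 4)) *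
      Real.exp (-(k * (1 - (ZMod.stdAddChar (2 * (α * a₂ + β * b₂))).re) / 4)) := by
  have h (a : ZMod n) :
      (ZMod.stdAddChar (2 * a)).re = 2 * (ZMod.stdAddChar a).re ^ 2 - 1 := by
    have h₁ := ZMod.norm_stdAddChar a
    have h₂ : ‖ZMod.stdAddChar a‖ ^ 2 = 1 := by rw [h₁]; norm_num
    rw [← Complex.normSq_eq_norm_sq, Complex.normSq_apply] at h₂
    rw [two_mul, AddChar.map_add_eq_mul, Complex.mul_re]
    linarith
  rw [hp.charFourier_eq, norm_pow, Complex.norm_real, Real.norm_eq_abs, ← pow_mul,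
    mul_comm k 2, pow_mul, sq_abs, h, h, ← Real.exp_add]
  set u := (ZMod.stdAddChar (α * a₁ + β * b₁)).re
  set v := (ZMod.stdAddChar (α * a₂ + β * b₂)).re
  have h₁ : ((u + v) / 2) ^ 2 ≤ Real.exp (-((1 - u ^ 2) / 2 + (1 - v ^ 2) / 2)) := by
    refine le_trans ?_ (Real.one_sub_le_exp_neg _)
    nlinarith [sq_nonneg (u - v)]
  refine (pow_le_pow_left₀ (sq_nonneg _) h₁ k).trans (le_of_eq ?_)
  rw [← Real.exp_nat_mul]
  congr 1
  ring

theorem sum_norm_charFourier_sq_le (hp : IsFourStepWalk a₁ b₁ c₁ a₂ b₂ c₂ p) (hn : n ≠ 2)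
    (hd : b₁ * a₂ ≠ b₂ * a₁) {k : ℕ} (hk : n ^ 2 ≤ k) :
    ∑ w : ZMod n × ZMod n, ‖charFourier (p k) w.1 w.2‖ ^ 2 ≤
      (1 + 4 * Real.exp (-(2 * k / n ^ 2))) ^ 2 := by
  have h2 := ZMod.two_ne_zero_of_ne_two hn
  refine (Finset.sum_le_sum fun w _ => hp.norm_charFourier_sq_le k w.1 w.2).trans ?_
  rw [(dual_bijective hd).sum_comp fun w : ZMod n × ZMod n =>
      Real.exp (-(k * (1 - (ZMod.stdAddChar (2 * w.1)).re) / 4)) *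
      Real.exp (-(k * (1 - (ZMod.stdAddChar (2 * w.2)).re) / 4)), Fintype.sum_prod_type]
  simp only
  rw [← Finset.sum_mul_sum, ← sq, (mulLeft_bijective₀ (2 : ZMod n) h2).sum_comp fun a =>
      Real.exp (-(k * (1 - (ZMod.stdAddChar a).re) / 4))]
  exact pow_le_pow_left₀ (Finset.sum_nonneg fun _ _ => (Real.exp_pos _).le)
    (ZMod.sum_exp_stdAddChar_re_le hk) 2

theorem card_mul_sum_sq_sub_one_le (hp : IsFourStepWalk a₁ b₁ c₁ a₂ b₂ c₂ p) (hn : n ≠ 2)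
    (hd : b₁ * a₂ ≠ b₂ * a₁) {k : ℕ} (hk : n ^ 2 ≤ k) :
    (n : ℝ) ^ 3 * ∑ g, p k g ^ 2 - 1 ≤
      24 * Real.exp (-(2 * k / n ^ 2)) + n ^ 3 * Real.exp (-(k / (6 * n))) := by
  have h₁ : ∑ m ∈ Finset.univ.erase (0 : ZMod n), ‖centralFourier (p k) m‖ ^ 2 ≤
      n * Real.exp (-(k / (6 * n))) := by
    refine (Finset.sum_le_card_nsmul _ _ _ fun m hm =>
      hp.norm_centralFourier_sq_le hn hd k (Finset.ne_of_mem_erase hm)).trans ?_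
    rw [nsmul_eq_mul]
    gcongr
    refine (Finset.card_erase_le).trans ?_
    rw [Finset.card_univ, ZMod.card]
  have h₂ := sum_norm_charFourier_sq (p k)
  have h₃ := hp.sum_norm_charFourier_sq_le hn hd hk
  have h₄ := sum_norm_centralFourier_sq (p k)
  rw [← Finset.add_sum_erase _ _ (Finset.mem_univ 0)] at h₄
  have h₅ : (n : ℝ) ^ 3 * ∑ g, p k g ^ 2 = n ^ 2 * ‖centralFourier (p k) 0‖ ^ 2 +
      n ^ 2 * ∑ m ∈ Finset.univ.erase (0 : ZMod n), ‖centralFourier (p k) m‖ ^ 2 := by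
    linear_combination (-(n : ℝ) ^ 2) * h₄
  have h₆ : (n : ℝ) ^ 2 * ∑ m ∈ Finset.univ.erase (0 : ZMod n), ‖centralFourier (p k) m‖ ^ 2 ≤
      n ^ 2 * (n * Real.exp (-(k / (6 * n)))) := by gcongr
  have h₇ : Real.exp (-(2 * k / n ^ 2)) ≤ 1 := Real.exp_le_one_iff.mpr (by
    rw [neg_nonpos]; positivity)
  have h₈ := Real.exp_pos (-(2 * (k : ℝ) / n ^ 2))
  rw [h₅, ← h₂]
  nlinarith

end IsFourStepWalk

/-- The step set `{(a₁, b₁, 0), (-a₁, -b₁, c₁), (a₂, b₂, 0), (-a₂, -b₂, c₂)}`. -/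
def fourSteps {R : Type*} [CommRing R] [DecidableEq R] (a₁ b₁ c₁ a₂ b₂ c₂ : R) :
    Finset (Heisenberg R) :=
  {⟨a₁, b₁, 0⟩, ⟨-a₁, -b₁, c₁⟩, ⟨a₂, b₂, 0⟩, ⟨-a₂, -b₂, c₂⟩}

theorem sum_fourSteps {n : ℕ} [Fact n.Prime] (hn : n ≠ 2) {a₁ b₁ c₁ a₂ b₂ c₂ : ZMod n}
    (hd : b₁ * a₂ ≠ b₂ * a₁) {M : Type*} [AddCommMonoid M] (F : Heisenberg (ZMod n) → M) :
    ∑ s ∈ fourSteps a₁ b₁ c₁ a₂ b₂ c₂, F s =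
      F ⟨a₁, b₁, 0⟩ + F ⟨-a₁, -b₁, c₁⟩ + (F ⟨a₂, b₂, 0⟩ + F ⟨-a₂, -b₂, c₂⟩) := by
  have h2 := ZMod.two_ne_zero_of_ne_two hn
  have hz (a : ZMod n) (h : a = -a) : a = 0 := by
    have : 2 * a = 0 := by linear_combination h
    exact (mul_eq_zero.mp this).resolve_left h2
  have h₁ (h : a₁ = -a₁) (h' : b₁ = -b₁) : False := hd (by rw [hz _ h, hz _ h']; ring)
  have h₂ (h : a₂ = -a₂) (h' : b₂ = -b₂) : False := hd (by rw [hz _ h, hz _ h']; ring)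
  have h₃ (h : a₁ = a₂) (h' : b₁ = b₂) : False := hd (by rw [h, h'])
  have h₄ (h : a₁ = -a₂) (h' : b₁ = -b₂) : False := hd (by rw [h, h']; ring)
  have h₅ (h : -a₁ = a₂) (h' : -b₁ = b₂) : False := hd (by rw [← h, ← h']; ring)
  have h₆ (h : -a₁ = -a₂) (h' : -b₁ = -b₂) : False := h₃ (neg_inj.mp h) (neg_inj.mp h')
  rw [fourSteps, Finset.sum_insert, Finset.sum_insert, Finset.sum_insert, Finset.sum_singleton,
    add_assoc]
  · simp only [Finset.mem_singleton, Heisenberg.mk.injEq]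
    exact fun h => h₂ h.1 h.2.1
  · simp only [Finset.mem_insert, Finset.mem_singleton, Heisenberg.mk.injEq]
    rintro (h | h)
    exacts [h₅ h.1 h.2.1, h₆ h.1 h.2.1]
  · simp only [Finset.mem_insert, Finset.mem_singleton, Heisenberg.mk.injEq]
    rintro (h | h | h)
    exacts [h₁ h.1 h.2.1, h₃ h.1 h.2.1, h₄ h.1 h.2.1]

theorem isFourStepWalk_walkLaw {n : ℕ} [Fact n.Prime] (hn : n ≠ 2)
    {a₁ b₁ c₁ a₂ b₂ c₂ : ZMod n} (hd : b₁ * a₂ ≠ b₂ * a₁)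
    (hS : (fourSteps a₁ b₁ c₁ a₂ b₂ c₂).Nonempty) :
    IsFourStepWalk a₁ b₁ c₁ a₂ b₂ c₂ fun k g => (walkLaw _ hS k g).toReal where
  zero g := by
    simp only [walkLaw, PMF.pure_apply]
    split_ifs <;> simp
  succ k g := by
    have hc : (fourSteps a₁ b₁ c₁ a₂ b₂ c₂).card = 4 := by
      rw [Finset.card_eq_sum_ones, sum_fourSteps hn hd]; rfl
    rw [walkLaw_succ_toReal, sum_fourSteps hn hd, hc]
    norm_num

/-! ### The two bounds -/

theorem exp_le_two_mul_tvDist {n : ℕ} [Fact n.Prime] (hn : n ≠ 2) {a₁ b₁ c₁ a₂ b₂ c₂ : ZMod n}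
    (hd : b₁ * a₂ ≠ b₂ * a₁) (hS : (fourSteps a₁ b₁ c₁ a₂ b₂ c₂).Nonempty) (k : ℕ) :
    Real.exp (-(4 * Real.pi ^ 2 * k / n ^ 2)) ≤
      2 * tvDist (walkLaw _ hS k) (PMF.uniformOfFintype (Heisenberg (ZMod n))) := by
  have hp := isFourStepWalk_walkLaw hn hd hS
  have hn3 : 3 ≤ n := by
    have := (Fact.out : n.Prime).two_le
    omega
  have hn3' : (3 : ℝ) ≤ n := by exact_mod_cast hn3
  obtain ⟨⟨α, β⟩, hw⟩ := (IsFourStepWalk.dual_bijective hd).2 (0, 1)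
  obtain ⟨h₁, h₂⟩ := Prod.ext_iff.mp hw
  simp only at h₁ h₂
  have hb := norm_sum_sub_le_two_mul_tvDist (walkLaw _ hS k)
    (PMF.uniformOfFintype (Heisenberg (ZMod n)))
    (F := fun g => ZMod.stdAddChar (α * g.x + β * g.y)) fun g => (ZMod.norm_stdAddChar _).le
  have hu : ∑ g : Heisenberg (ZMod n),
      ((PMF.uniformOfFintype (Heisenberg (ZMod n)) g).toReal : ℂ) *
        ZMod.stdAddChar (α * g.x + β * g.y) = 0 := by
    simp only [PMF.uniformOfFintype_apply]
    rw [← Finset.mul_sum]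
    refine mul_eq_zero_of_right _ ?_
    have e : ∑ g : Heisenberg (ZMod n), ZMod.stdAddChar (α * g.x + β * g.y) =
        ZMod.stdAddChar (1 : ZMod n) *
          ∑ g : Heisenberg (ZMod n), ZMod.stdAddChar (α * g.x + β * g.y) := by
      conv_lhs => rw [← Equiv.sum_comp (Equiv.mulRight (⟨a₂, b₂, 0⟩ : Heisenberg (ZMod n)))]
      rw [Finset.mul_sum]
      refine Finset.sum_congr rfl fun g _ => ?_
      rw [← AddChar.map_add_eq_mul, ← h₂]
      congr 1
      simp only [Equiv.coe_mulRight, mul_def]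
      ring
    have h1 : ZMod.stdAddChar (1 : ZMod n) ≠ 1 := by
      have : Fact (1 < n) := ⟨by omega⟩
      intro h
      have := ZMod.injective_stdAddChar (h.trans (AddChar.map_zero_eq_one _).symm)
      exact one_ne_zero this
    by_contra h
    exact h1 (mul_right_cancel₀ h (by rw [one_mul]; exact e.symm))
  have hc := hp.charFourier_eq k α β
  rw [charFourier] at hc
  rw [hu, sub_zero, hc, norm_pow, Complex.norm_real, h₁, h₂] at hb
  refine le_trans ?_ hb
  have h1re : (ZMod.stdAddChar (1 : ZMod n)).re = Real.cos (2 * Real.pi / n) := by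
    have := ZMod.stdAddChar_re (n := n) 1
    simpa using this
  have hcos : ((ZMod.stdAddChar (0 : ZMod n)).re + (ZMod.stdAddChar (1 : ZMod n)).re) / 2 =
      Real.cos (Real.pi / n) ^ 2 := by
    rw [h1re, AddChar.map_zero_eq_one, Complex.one_re,
      show 2 * Real.pi / (n : ℝ) = 2 * (Real.pi / n) by ring, Real.cos_two_mul]
    ring
  rw [hcos, Real.norm_of_nonneg (sq_nonneg _)]
  have hle : Real.exp (-(4 * Real.pi ^ 2 / n ^ 2)) ≤ Real.cos (Real.pi / n) ^ 2 := by
    have hx0 : 0 ≤ Real.pi / n := by positivity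
    have hx : Real.pi / n ≤ Real.pi / 3 := by gcongr
    have hc : 1 / 2 ≤ Real.cos (Real.pi / n) := by
      rw [← Real.cos_pi_div_three]
      exact Real.cos_le_cos_of_nonneg_of_le_pi hx0 (by linarith [Real.pi_pos]) hx
    have hs : Real.sin (Real.pi / n) ≤ Real.pi / n := Real.sin_le hx0
    have hs0 : 0 ≤ Real.sin (Real.pi / n) :=
      Real.sin_nonneg_of_nonneg_of_le_pi hx0 (by linarith [Real.pi_pos])
    have hsc := Real.sin_sq_add_cos_sq (Real.pi / n)
    have hE : 1 + 4 * (Real.pi / n) ^ 2 ≤ Real.exp (4 * Real.pi ^ 2 / n ^ 2) := by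
      have := Real.add_one_le_exp (4 * Real.pi ^ 2 / (n : ℝ) ^ 2)
      rw [div_pow]
      rw [mul_div_assoc] at this ⊢
      linarith
    rw [Real.exp_neg, inv_le_comm₀ (Real.exp_pos _) (by positivity)]
    refine le_trans ?_ hE
    rw [inv_le_iff_one_le_mul₀ (by positivity)]
    have h₃ : Real.sin (Real.pi / n) ^ 2 ≤ (Real.pi / n) ^ 2 := by gcongr
    have h₄ : (1 / 4 : ℝ) ≤ Real.cos (Real.pi / n) ^ 2 := by nlinarith
    nlinarith
  calc Real.exp (-(4 * Real.pi ^ 2 * k / n ^ 2))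
      = Real.exp (-(4 * Real.pi ^ 2 / n ^ 2)) ^ k := by
        rw [← Real.exp_nat_mul]; congr 1; ring
    _ ≤ _ := pow_le_pow_left₀ (Real.exp_pos _).le hle k

theorem tvDist_le_exp {n : ℕ} [Fact n.Prime] (hn : n ≠ 2) {a₁ b₁ c₁ a₂ b₂ c₂ : ZMod n}
    (hd : b₁ * a₂ ≠ b₂ * a₁) (hS : (fourSteps a₁ b₁ c₁ a₂ b₂ c₂).Nonempty) (k : ℕ) :
    tvDist (walkLaw _ hS k) (PMF.uniformOfFintype (Heisenberg (ZMod n))) ≤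
      100 * Real.exp (-(k / (24 * n ^ 2))) := by
  have hn1 : (1 : ℝ) ≤ n := by exact_mod_cast (Fact.out : n.Prime).one_le
  rcases le_or_gt (n ^ 2) k with hk | hk
  · have hk' : (n : ℝ) ^ 2 ≤ k := by exact_mod_cast hk
    have h₁ := four_mul_tvDist_uniform_sq_le (walkLaw _ hS k)
    rw [card_eq, ZMod.card] at h₁
    push_cast at h₁
    have h₂ := (isFourStepWalk_walkLaw hn hd hS).card_mul_sum_sq_sub_one_le hn hd hk
    have h₃ : Real.exp (-(2 * k / n ^ 2)) ≤ Real.exp (-(k / (12 * n ^ 2))) := by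
      rw [Real.exp_le_exp, neg_le_neg_iff]
      rw [div_le_div_iff₀ (by positivity) (by positivity)]
      have : (0 : ℝ) ≤ k * n ^ 2 := by positivity
      nlinarith
    have h₄ : (n : ℝ) ^ 3 * Real.exp (-(k / (6 * n))) ≤
        10368 * Real.exp (-(k / (12 * n ^ 2))) := by
      have e : Real.exp (-(k / (6 * n))) =
          Real.exp (-(k / (12 * n))) * Real.exp (-(k / (12 * n))) := by
        rw [← Real.exp_add]; congr 1; field_simp; ring
      have h₅ : Real.exp (-(k / (12 * n))) ≤ Real.exp (-(k / (12 * n ^ 2))) := by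
        gcongr
        nlinarith
      have h₆ : (n : ℝ) ^ 3 * Real.exp (-(k / (12 * n))) ≤ 10368 := by
        have h₇ : (n : ℝ) / 12 ≤ k / (12 * n) := by
          rw [div_le_div_iff₀ (by positivity) (by positivity)]
          nlinarith
        have h₈ : Real.exp (-(k / (12 * n))) ≤ Real.exp (-(n / 12 : ℝ)) := by gcongr
        have h₉ := Real.pow_div_factorial_le_exp (n / 12 : ℝ) (by positivity) 3
        have h₁₀ : (n : ℝ) ^ 3 ≤ 10368 * Real.exp (n / 12 : ℝ) := by
          norm_num [Nat.factorial] at h₉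
          linarith
        calc (n : ℝ) ^ 3 * Real.exp (-(k / (12 * n)))
            ≤ (10368 * Real.exp (n / 12 : ℝ)) * Real.exp (-(n / 12 : ℝ)) := by gcongr
          _ = 10368 := by rw [mul_assoc, ← Real.exp_add]; simp
      rw [e, ← mul_assoc]
      gcongr
    have e : Real.exp (-(k / (12 * n ^ 2))) = Real.exp (-(k / (24 * n ^ 2))) ^ 2 := by
      rw [← Real.exp_nat_mul]; congr 1; field_simp; ring
    refine le_of_sq_le_sq ?_ (by positivity)
    rw [mul_pow, ← e]
    have := Real.exp_pos (-(k / (12 * n ^ 2) : ℝ))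
    linarith
  · have hk' : (k : ℝ) ≤ n ^ 2 := by exact_mod_cast hk.le
    refine (tvDist_le_one _ _).trans ?_
    have h₁ : (k : ℝ) / (24 * n ^ 2) ≤ 1 / 24 := by
      rw [div_le_div_iff₀ (by positivity) (by positivity)]
      linarith
    have h₂ := Real.one_sub_le_exp_neg ((k : ℝ) / (24 * n ^ 2))
    linarith

end Heisenberg

theorem mainTheorem2 :
    ∃ a b B : ℝ, 0 < a ∧ 0 < b ∧ 0 < B ∧
      ∀ (n : ℕ) [Fact n.Prime], n ≠ 2 →
      ∀ r₁ s₁ r₂ s₂ : ZMod n, r₁ * s₂ ≠ r₂ * s₁ →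
      ∀ (S : Finset (Heisenberg (ZMod n))) (hS : S.Nonempty),
        (S = Heisenberg.negSteps r₁ s₁ r₂ s₂ ∨ S = Heisenberg.invSteps r₁ s₁ r₂ s₂) →
      ∀ k : ℕ,
        (1 / 2) * Real.exp (-a * k / n ^ 2)
            ≤ tvDist (walkLaw S hS k) (PMF.uniformOfFintype (Heisenberg (ZMod n))) ∧
        tvDist (walkLaw S hS k) (PMF.uniformOfFintype (Heisenberg (ZMod n)))
            ≤ B * Real.exp (-b * k / n ^ 2) := by
  refine ⟨4 * Real.pi ^ 2, 1 / 24, 100, by positivity, by norm_num, by norm_num, ?_⟩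
  intro n _ hn r₁ s₁ r₂ s₂ hd S hS hS' k
  obtain ⟨c₁, c₂, rfl⟩ : ∃ c₁ c₂, S = Heisenberg.fourSteps s₁ r₁ c₁ s₂ r₂ c₂ := by
    rcases hS' with rfl | rfl
    exacts [⟨0, 0, rfl⟩, ⟨-0 + s₁ * r₁, -0 + s₂ * r₂, rfl⟩]
  have h₁ := Heisenberg.exp_le_two_mul_tvDist hn hd hS k
  have h₂ := Heisenberg.tvDist_le_exp hn hd hS k
  rw [show -(4 * Real.pi ^ 2) * k / (n : ℝ) ^ 2 = -(4 * Real.pi ^ 2 * k / n ^ 2) by ring,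
    show -(1 / 24) * k / (n : ℝ) ^ 2 = -(k / (24 * n ^ 2)) by ring]
  exact ⟨by linarith, h₂⟩
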